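/- Let $1\le p\le\infty$; all Banach spaces are over the same scalar field, $\mathbb R$ or $\mathbb C$. A sequence $(x_n)$ in a Banach space $E$ is weakly $p$-summable if $(f(x_n))_n\in\ell_p$ for every $f\in E^*$ (for $p=\infty$: if it is weakly null); it is weakly $p$-convergent to $a$ if $(x_n-a)$ is weakly $p$-summable. A set $K\subset E$ is weakly $p$-compact if each sequence in $K$ has a weakly $p$-convergent subsequence and the limits of weakly $p$-convergent sequences in $K$ lie in $K$. A bounded set $K\subset E$ is Dunford–Pettis if every weakly null sequence $(f_n)$ in $E^*$ satisfies $\sup_{x\in K}|f_n(x)|\to0$. A sequence is $p$-Right null if it is weakly $p$-summable and its range is a Dunford–Pettis set. A bounded set $K\subset E$ is a $p$-Right$^*$ set if $\sup_{x\in K}|f_n(x)|\to0$ for every $p$-Right null sequence $(f_n)$ in $E^*$. $E$ has the $p$-$(SR^*)$ property if every $p$-Right$^*$ set in $E$ is relatively weakly compact. An operator (bounded linear map) is pseudo weakly compact of order $p$ if it carries Dunford–Pettis weakly $p$-compact sets to relatively norm compact sets, and weakly compact if it maps the closed unit ball to a relatively weakly compact set. Put $\hat d(K,A)=\sup_{a\in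 K}d(a,A)$ and, for bounded $K\subset E$, $$\omega(K)=\inf\{\hat d(K,A):\emptyset\ne A\subset E\text{ weakly compact}\},\qquad \vartheta_p(K)=\inf\{\hat d(K,A):\emptyset\ne A\subset E\text{ a }p\text{-Right}^*\text{ set}\};$$ for an operator $T:Y\to E$ put $\omega(T)=\omega(T(B_Y))$ and $\vartheta_p(T)=\vartheta_p(T(B_Y))$, where $B_Y$ is the closed unit ball of $Y$. **Theorem.** Let $X$ be a Banach space. The following are equivalent: (i) for every Banach space $Y$, every operator $T:Y\to X$ whose adjoint $T^*:X^*\to Y^*$ is pseudo weakly compact of order $p$ is weakly compact; (ii) every operator $T:\ell_1\to X$ whose adjoint is pseudo weakly compact of order $p$ is weakly compact; (iii) $X$ has the $p$-$(SR^*)$ property; (iv) $\omega(T)\le\vartheta_p(T)$ for every Banach space $Y$ and every operator $T:Y\to X$; (v) $\omega(K)\le\vartheta_p(K)$ for every bounded set $K\subset X$. -/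

import Mathlib

open Filter Topology ENNReal

universe v w

noncomputable section

namespace RightStar

variable (𝕜 : Type*) [RCLike 𝕜]

section Sequences

variable {E : Type*} [NormedAddCommGroup E] [NormedSpace 𝕜 E]

/-- Weakly null sequence: `f (x n) → 0` for every `f` in the dual space. -/
def WeaklyNull (x : ℕ → E) : Prop :=
  ∀ f : StrongDual 𝕜 E, Tendsto (fun n => f (x n)) atTop (𝓝 0)

/-- Weakly `p`-summable sequence: `(f (x n))` is in `ℓ_p` for every `f` in the dual space.
For `p = ∞` the usual convention applies: `c₀` takes the place of `ℓ_∞`, that is, the weakly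
`∞`-summable sequences are the weakly null ones. -/
def WeaklyPSummable (p : ℝ≥0∞) (x : ℕ → E) : Prop :=
  (p = ∞ → WeaklyNull 𝕜 x) ∧
    (p ≠ ∞ → ∀ f : StrongDual 𝕜 E, Memℓp (fun n => f (x n)) p)

/-- `(x n)` is weakly `p`-convergent to `a`. -/
def WeaklyPConvergent (p : ℝ≥0∞) (x : ℕ → E) (a : E) : Prop :=
  WeaklyPSummable 𝕜 p (fun n => x n - a)

end Sequences

section Sets

variable {E : Type*} [NormedAddCommGroup E] [NormedSpace 𝕜 E]

/-- Dunford-Pettis set: a bounded set on which every weakly null sequence of the dual space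
converges uniformly to zero. -/
def IsDunfordPettisSet (K : Set E) : Prop :=
  Bornology.IsBounded K ∧
    ∀ f : ℕ → StrongDual 𝕜 E, WeaklyNull 𝕜 f →
      TendstoUniformlyOn (fun n x => f n x) (fun _ => 0) atTop K

/-- Weakly `p`-compact set: each sequence in `K` has a weakly `p`-convergent subsequence, and the
limits of weakly `p`-convergent sequences in `K` lie in `K`. -/
def IsWeaklyPCompact (p : ℝ≥0∞) (K : Set E) : Prop :=
  (∀ x : ℕ → E, (∀ n, x n ∈ K) →
      ∃ (φ : ℕ → ℕ) (a : E), StrictMono φ ∧ WeaklyPConvergent 𝕜 p (x ∘ φ) a) ∧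
    ∀ (x : ℕ → E) (a : E), (∀ n, x n ∈ K) → WeaklyPConvergent 𝕜 p x a → a ∈ K

/-- `p`-Right null sequence: a weakly `p`-summable sequence whose range is a Dunford-Pettis set. -/
def PRightNull (p : ℝ≥0∞) (x : ℕ → E) : Prop :=
  IsDunfordPettisSet 𝕜 (Set.range x) ∧ WeaklyPSummable 𝕜 p x

/-- `p`-Right* set: a bounded set on which every `p`-Right null sequence of the dual space
converges uniformly to zero. -/
def IsPRightStarSet (p : ℝ≥0∞) (K : Set E) : Prop :=
  Bornology.IsBounded K ∧
    ∀ f : ℕ → StrongDual 𝕜 E, PRightNull 𝕜 p f →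
      TendstoUniformlyOn (fun n x => f n x) (fun _ => 0) atTop K

/-- Weakly compact set. -/
def IsWeaklyCompact (K : Set E) : Prop :=
  IsCompact (toWeakSpace 𝕜 E '' K)

/-- Relatively weakly compact set: its weak closure is weakly compact. -/
def IsRelativelyWeaklyCompact (K : Set E) : Prop :=
  IsCompact (closure (toWeakSpace 𝕜 E '' K))

/-- The `p`-sequentially Right* property. -/
def HasPSRStar (p : ℝ≥0∞) (E : Type*) [NormedAddCommGroup E] [NormedSpace 𝕜 E] : Prop :=
  ∀ K : Set E, IsPRightStarSet 𝕜 p K → IsRelativelyWeaklyCompact 𝕜 K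

/-- The non-symmetrized Hausdorff distance `sup {d(a, B) : a ∈ A}`. -/
def excess (A B : Set E) : ℝ≥0∞ :=
  ⨆ a ∈ A, Metric.infEDist a B

/-- The de Blasi measure of weak non-compactness. -/
def deBlasi (K : Set E) : ℝ≥0∞ :=
  ⨅ (A : Set E) (_ : A.Nonempty) (_ : IsWeaklyCompact 𝕜 A), excess K A

/-- The quantity `ϑ_p(K)`, the distance of `K` from the nonempty `p`-Right* sets. -/
def vartheta (p : ℝ≥0∞) (K : Set E) : ℝ≥0∞ :=
  ⨅ (A : Set E) (_ : A.Nonempty) (_ : IsPRightStarSet 𝕜 p A), excess K A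

end Sets

section Operators

variable {𝕜}
variable {E F : Type*} [NormedAddCommGroup E] [NormedSpace 𝕜 E]
  [NormedAddCommGroup F] [NormedSpace 𝕜 F]

/-- The adjoint `T* : F* → E*`, `T* f = f ∘ T`. -/
def dualOperator (T : E →L[𝕜] F) : StrongDual 𝕜 F →L[𝕜] StrongDual 𝕜 E :=
  ContinuousLinearMap.precomp 𝕜 T

theorem dualOperator_apply (T : E →L[𝕜] F) (f : StrongDual 𝕜 F) (x : E) :
    dualOperator T f x = f (T x) := rfl

/-- Weakly compact operator: the image of the closed unit ball is relatively weakly compact. -/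
def IsWeaklyCompactOperator (T : E →L[𝕜] F) : Prop :=
  IsRelativelyWeaklyCompact 𝕜 (T '' Metric.closedBall 0 1)

/-- Pseudo weakly compact operator of order `p`: it carries Dunford-Pettis weakly `p`-compact sets
to relatively norm compact sets. -/
def IsPseudoWeaklyCompactOperator (p : ℝ≥0∞) (T : E →L[𝕜] F) : Prop :=
  ∀ K : Set E, IsDunfordPettisSet 𝕜 K → IsWeaklyPCompact 𝕜 p K → IsCompact (closure (T '' K))

/-- `ω(T) = ω(T(B_E))`. -/
def deBlasiOperator (T : E →L[𝕜] F) : ℝ≥0∞ :=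
  deBlasi 𝕜 (T '' Metric.closedBall 0 1)

/-- `ϑ_p(T) = ϑ_p(T(B_E))`. -/
def varthetaOperator (p : ℝ≥0∞) (T : E →L[𝕜] F) : ℝ≥0∞ :=
  vartheta 𝕜 p (T '' Metric.closedBall 0 1)

end Operators

end RightStar

end

open RightStar

/-!
Testing the adjoint `T*` on the sets `{0} ∪ {fₙ : n ∈ ℕ}` with `(fₙ)` a `p`-Right null sequence
shows that `T*` is pseudo weakly compact of order `p` if and only if `‖T* fₙ‖ → 0` for all such
`(fₙ)`. Since `‖T* f‖` is the supremum of `|f|` over `T(B_Y)`, this says that `T(B_Y)` is a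
`p`-Right* set. So (i) and (ii) are instances of (iii).

Conversely, a sequence in a `p`-Right* set is the image of the unit vectors under an operator
`T : ℓ₁ → X`, and `T(B_{ℓ₁})` is again a `p`-Right* set because a bound for a functional on the
sequence is a bound for it on `T(B_{ℓ₁})`. Hence (ii) yields weak cluster points for all sequences
in a `p`-Right* set, and the Eberlein–Šmulian theorem, proved by Whitley's argument, yields (iii).

Under (iii) the weak closures of `p`-Right* sets compete in the infimum defining `ω`, which is (v).
Finally (iv) gives (i) because `ϑ_p` vanishes on `p`-Right* sets and, by Grothendieck's criterion,
a bounded set `K` with `ω(K) = 0` in a Banach space is relatively weakly compact.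
-/

namespace RightStar

variable {𝕜 : Type*} [RCLike 𝕜]

section Whitley

variable {D : Type*} [NormedAddCommGroup D] [NormedSpace 𝕜 D]

/-- The vectors of `N` in the unit ball norm the functionals in `V` up to a factor `2`. In Whitley's
argument `V` is a subspace of a bidual, and values on `N` then determine the elements of its norm
closure. -/
def IsHalfNorming (N : Set D) (V : Set (StrongDual 𝕜 D)) : Prop :=
  ∀ Ψ ∈ V, ∃ g ∈ N, ‖g‖ ≤ 1 ∧ ‖Ψ‖ ≤ 2 * ‖Ψ g‖

theorem exists_finset_isHalfNorming (V : Submodule 𝕜 (StrongDual 𝕜 D)) [FiniteDimensional 𝕜 V] :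
    ∃ G : Finset D, IsHalfNorming (G : Set D) (V : Set (StrongDual 𝕜 D)) := by
  classical
  have : ProperSpace V := FiniteDimensional.proper_rclike 𝕜 V
  obtain ⟨t, ht⟩ := (isCompact_sphere (0 : V) 1).elim_finite_subcover
    (fun g : Metric.closedBall (0 : D) 1 => {Ψ : V | 1 / 2 < ‖(Ψ : StrongDual 𝕜 D) g‖})
    (fun g => isOpen_lt continuous_const (by fun_prop)) fun Ψ hΨ => by
      have hΨ1 : ‖(Ψ : StrongDual 𝕜 D)‖ = 1 := mem_sphere_zero_iff_norm.1 hΨ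
      obtain ⟨g, hg, hlt⟩ := (Ψ : StrongDual 𝕜 D).exists_lt_apply_of_lt_opNorm (r := 1 / 2)
        (by rw [hΨ1]; norm_num)
      exact Set.mem_iUnion.2 ⟨⟨g, mem_closedBall_zero_iff.2 hg.le⟩, hlt⟩
  refine ⟨insert 0 (t.image Subtype.val), fun Ψ hΨ => ?_⟩
  obtain rfl | h0 := eq_or_ne Ψ 0
  · exact ⟨0, by simp⟩
  have hpos : 0 < ‖Ψ‖ := norm_pos_iff.2 h0
  have hsphere : ((‖Ψ‖ : 𝕜)⁻¹ • ⟨Ψ, hΨ⟩ : V) ∈ Metric.sphere (0 : V) 1 :=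
    (mem_sphere_zero_iff_norm (E := V)).2 (norm_smul_inv_norm (𝕜 := 𝕜) h0)
  obtain ⟨g, hg, hlt⟩ := Set.mem_iUnion₂.1 (ht hsphere)
  have hlt' : 1 / 2 < ‖Ψ‖⁻¹ * ‖Ψ g‖ := by simpa using hlt
  rw [inv_mul_eq_div, lt_div_iff₀ hpos] at hlt'
  exact ⟨g, by simp [hg, mem_closedBall_zero_iff.1 g.2], mem_closedBall_zero_iff.1 g.2, by linarith⟩

theorem IsHalfNorming.eq_zero_of_mem_closure {N : Set D} {V : Set (StrongDual 𝕜 D)}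
    (hN : IsHalfNorming N V) {Ψ : StrongDual 𝕜 D} (hΨ : Ψ ∈ closure V) (h0 : ∀ g ∈ N, Ψ g = 0) :
    Ψ = 0 := by
  refine norm_le_zero_iff.1 (le_of_forall_pos_le_add fun ε hε => ?_)
  obtain ⟨Ψ', hΨ', hdist⟩ := Metric.mem_closure_iff.1 hΨ (ε / 3) (by positivity)
  obtain ⟨g, hgN, hg1, hg⟩ := hN Ψ' hΨ'
  have hΨ'g : ‖Ψ' g‖ ≤ ‖Ψ' - Ψ‖ := by
    simpa [h0 g hgN] using (Ψ' - Ψ).unit_le_opNorm g hg1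
  have htri : ‖Ψ‖ ≤ ‖Ψ'‖ + ‖Ψ' - Ψ‖ := by
    simpa using norm_sub_le Ψ' (Ψ' - Ψ)
  rw [dist_comm, dist_eq_norm] at hdist
  linarith

theorem exists_mem_forall_norm_sub_lt {B : Set (StrongDual 𝕜 D)} {Φ : StrongDual 𝕜 D}
    (hΦ : StrongDual.toWeakDual Φ ∈ closure (StrongDual.toWeakDual '' B)) (G : Finset D)
    {ε : ℝ} (hε : 0 < ε) : ∃ Ψ ∈ B, ∀ g ∈ G, ‖Ψ g - Φ g‖ < ε := by
  have hnear : ∀ᶠ Ψ in 𝓝 (StrongDual.toWeakDual Φ), ∀ g ∈ G, ‖Ψ g - Φ g‖ < ε :=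
    (Finset.eventually_all G).2 fun g _ =>
      ((WeakDual.eval_continuous g).sub continuous_const).norm.continuousAt.eventually_lt_const
        (by simpa using hε)
  obtain ⟨_, ⟨Ψ, hΨ, rfl⟩, h⟩ := ((mem_closure_iff_frequently.1 hΦ).and_eventually hnear).exists
  exact ⟨Ψ, hΨ, h⟩

theorem exists_seq_tendsto_of_isHalfNorming {B : Set (StrongDual 𝕜 D)} {Φ : StrongDual 𝕜 D}
    (hΦ : StrongDual.toWeakDual Φ ∈ closure (StrongDual.toWeakDual '' B)) :
    ∃ (b : ℕ → StrongDual 𝕜 D) (N : Set D), (∀ n, b n ∈ B) ∧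
      IsHalfNorming N (Submodule.span 𝕜 (insert Φ (Set.range b)) : Set (StrongDual 𝕜 D)) ∧
      ∀ g ∈ N, Tendsto (fun n => b n g) atTop (𝓝 (Φ g)) := by
  classical
  choose G hG using fun s : Finset (StrongDual 𝕜 D) =>
    exists_finset_isHalfNorming (Submodule.span 𝕜 (s : Set (StrongDual 𝕜 D)))
  choose c hcB hc using fun (n : ℕ) (s : Finset (StrongDual 𝕜 D)) =>
    exists_mem_forall_norm_sub_lt hΦ (s.powerset.biUnion G) (ε := 1 / ((n : ℝ) + 1))
      (by positivity)
  -- `S n = {Φ, b 0, …, b (n - 1)}`. Since `b n` is close to `Φ` on `G s` for every `s ⊆ S n`, the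
  -- sequence converges to `Φ` on each `G (S m)`.
  let S : ℕ → Finset (StrongDual 𝕜 D) := Nat.rec {Φ} fun n s => insert (c n s) s
  have hS : Monotone S := monotone_nat_of_le_succ fun n => Finset.subset_insert _ _
  refine ⟨fun n => c n (S n), ⋃ n, (G (S n) : Set D), fun n => hcB n _, fun Ψ hΨ => ?_,
    fun g hg => ?_⟩
  · have hcover : insert Φ (Set.range fun n => c n (S n)) ⊆
        ⋃ n, SetLike.coe (S n) := by
      rintro _ (rfl | ⟨n, rfl⟩)
      · exact Set.mem_iUnion.2 ⟨0, Finset.mem_singleton_self _⟩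
      · exact Set.mem_iUnion.2 ⟨n + 1, Finset.mem_insert_self _ _⟩
    have hdir : Directed (· ≤ ·) fun n => Submodule.span 𝕜 (SetLike.coe (S n)) :=
      Monotone.directed_le fun m n hmn => Submodule.span_mono (Finset.coe_subset.2 (hS hmn))
    have hΨS := Submodule.span_mono (R := 𝕜) hcover hΨ
    rw [Submodule.span_iUnion, Submodule.mem_iSup_of_directed _ hdir] at hΨS
    obtain ⟨n, hn⟩ := hΨS
    obtain ⟨g, hg, hg'⟩ := hG (S n) Ψ hn
    exact ⟨g, Set.mem_iUnion.2 ⟨n, hg⟩, hg'⟩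
  · obtain ⟨m, hm⟩ := Set.mem_iUnion.1 hg
    refine tendsto_iff_norm_sub_tendsto_zero.2 (squeeze_zero' (.of_forall fun _ => norm_nonneg _) ?_
      (tendsto_one_div_add_atTop_nhds_zero_nat (𝕜 := ℝ)))
    filter_upwards [eventually_ge_atTop m] with n hn
    exact (hc n (S n) g (Finset.mem_biUnion.2 ⟨S m, Finset.mem_powerset.2 (hS hn), hm⟩)).le

theorem eq_of_mapClusterPt_of_tendsto {ι α : Type*} [TopologicalSpace α] [T2Space α]
    {l : Filter ι} {u : ι → α} {a b : α} (ha : MapClusterPt a l u) (hb : Tendsto u l (𝓝 b)) :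
    a = b :=
  eq_of_nhds_neBot (ClusterPt.mono ha hb)

theorem exists_seq_forall_eq_of_mapClusterPt {B : Set (StrongDual 𝕜 D)} {Φ : StrongDual 𝕜 D}
    (hΦ : StrongDual.toWeakDual Φ ∈ closure (StrongDual.toWeakDual '' B)) :
    ∃ b : ℕ → StrongDual 𝕜 D, (∀ n, b n ∈ B) ∧
      ∀ Ψ ∈ closure (Submodule.span 𝕜 (Set.range b) : Set (StrongDual 𝕜 D)),
        (∀ g, MapClusterPt (Ψ g) atTop fun n => b n g) → Ψ = Φ := by
  obtain ⟨b, N, hbB, hN, hlim⟩ := exists_seq_tendsto_of_isHalfNorming hΦ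
  refine ⟨b, hbB, fun Ψ hΨ hcluster => sub_eq_zero.1 (hN.eq_zero_of_mem_closure ?_ fun g hg => ?_)⟩
  · rw [← Submodule.topologicalClosure_coe] at hΨ ⊢
    exact Submodule.sub_mem _
      (Submodule.topologicalClosure_mono (Submodule.span_mono (Set.subset_insert _ _)) hΨ)
      (Submodule.le_topologicalClosure _ (Submodule.subset_span (Set.mem_insert _ _)))
  · exact sub_eq_zero.2 (eq_of_mapClusterPt_of_tendsto (hcluster g) (hlim g hg))

end Whitley

section WeakCompactness

open NormedSpace
open scoped Pointwise

variable {E : Type*} [NormedAddCommGroup E] [NormedSpace 𝕜 E]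

theorem isRelativelyWeaklyCompact_of_closure_bidual {K : Set E} (hb : Bornology.IsBounded K)
    (h : ∀ Φ : StrongDual 𝕜 (StrongDual 𝕜 E),
      StrongDual.toWeakDual Φ ∈
          closure (StrongDual.toWeakDual '' (inclusionInDoubleDual 𝕜 E '' K)) →
        Φ ∈ Set.range (inclusionInDoubleDual 𝕜 E)) :
    IsRelativelyWeaklyCompact 𝕜 K := by
  refine isCompact_closure_of_isBounded 𝕜 E _
    (by rwa [(toWeakSpace 𝕜 E).injective.preimage_image]) fun Φ' hΦ' => ?_
  obtain ⟨Φ, rfl⟩ := StrongDual.toWeakDual.surjective Φ'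
  rw [Set.image_image] at hΦ' h
  obtain ⟨x, hx⟩ := h Φ hΦ'
  exact ⟨toWeakSpace 𝕜 E x, congrArg StrongDual.toWeakDual hx⟩

theorem mem_closure_span_of_mapClusterPt {a : ℕ → E} {x : E}
    (h : MapClusterPt (toWeakSpace 𝕜 E x) atTop fun n => toWeakSpace 𝕜 E (a n)) :
    x ∈ closure (Submodule.span 𝕜 (Set.range a) : Set E) := by
  let _ : NormedSpace ℝ E := NormedSpace.restrictScalars ℝ 𝕜 E
  have hconv : Convex ℝ (Submodule.span 𝕜 (Set.range a) : Set E) :=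
    ((Submodule.span 𝕜 (Set.range a)).restrictScalars ℝ).convex
  rw [← (toWeakSpace 𝕜 E).injective.mem_set_image, hconv.toWeakSpace_closure 𝕜]
  refine mem_closure_iff_clusterPt.2
    (h.clusterPt.mono (tendsto_principal.2 (.of_forall fun n => ?_)))
  exact Set.mem_image_of_mem _ (Submodule.subset_span (Set.mem_range_self n))

/-- The hard direction of the **Eberlein–Šmulian theorem**. -/
theorem isRelativelyWeaklyCompact_of_mapClusterPt {K : Set E} (hb : Bornology.IsBounded K)
    (h : ∀ a : ℕ → E, (∀ n, a n ∈ K) →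
      ∃ x : E, MapClusterPt (toWeakSpace 𝕜 E x) atTop fun n => toWeakSpace 𝕜 E (a n)) :
    IsRelativelyWeaklyCompact 𝕜 K := by
  refine isRelativelyWeaklyCompact_of_closure_bidual hb fun Φ hΦ => ?_
  obtain ⟨b, hbK, hb⟩ := exists_seq_forall_eq_of_mapClusterPt hΦ
  choose a haK hab using hbK
  obtain ⟨x, hx⟩ := h a haK
  obtain rfl : (fun n => inclusionInDoubleDual 𝕜 E (a n)) = b := funext hab
  refine ⟨x, hb _ ?_ fun f => ?_⟩
  · have hmem := image_closure_subset_closure_image (inclusionInDoubleDual 𝕜 E).continuous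
      (Set.mem_image_of_mem _ (mem_closure_span_of_mapClusterPt hx))
    rwa [← ContinuousLinearMap.coe_coe, ← Submodule.map_coe, Submodule.map_span,
      ← Set.range_comp] at hmem
  · exact hx.continuousAt_comp
      (WeakBilin.eval_continuous (topDualPairing 𝕜 E).flip f).continuousAt

theorem IsRelativelyWeaklyCompact.exists_mapClusterPt {K : Set E}
    (hK : IsRelativelyWeaklyCompact 𝕜 K) {a : ℕ → E} (ha : ∀ n, a n ∈ K) :
    ∃ x : E, MapClusterPt (toWeakSpace 𝕜 E x) atTop fun n => toWeakSpace 𝕜 E (a n) := by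
  obtain ⟨y, -, hy⟩ := IsCompact.exists_mapClusterPt hK (f := (atTop : Filter ℕ))
    (u := fun n => toWeakSpace 𝕜 E (a n)) (tendsto_principal.2 (.of_forall fun n =>
      subset_closure (Set.mem_image_of_mem _ (ha n))))
  exact ⟨(toWeakSpace 𝕜 E).symm y, by simpa using hy⟩

theorem mem_add_closedBall_of_mem_closure {D : Type*} [NormedAddCommGroup D] [NormedSpace 𝕜 D]
    {A B : Set (StrongDual 𝕜 D)} {r : ℝ} (hA : IsCompact (StrongDual.toWeakDual '' A))
    (hAB : B ⊆ A + Metric.closedBall 0 r) {Φ : StrongDual 𝕜 D}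
    (hΦ : StrongDual.toWeakDual Φ ∈ closure (StrongDual.toWeakDual '' B)) :
    Φ ∈ A + Metric.closedBall 0 r := by
  have hball : IsCompact (StrongDual.toWeakDual '' Metric.closedBall (0 : StrongDual 𝕜 D) r) := by
    rw [LinearEquiv.image_eq_preimage_symm]
    exact WeakDual.isCompact_closedBall 0 r
  have hclosed : IsClosed (StrongDual.toWeakDual '' (A + Metric.closedBall 0 r)) := by
    rw [Set.image_add]
    exact (hA.add hball).isClosed
  exact StrongDual.toWeakDual.injective.mem_set_image.1
    (closure_minimal (Set.image_mono hAB) hclosed hΦ)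

theorem subset_add_ball_of_excess_lt {K A : Set E} {r : ℝ} (h : excess K A < ENNReal.ofReal r) :
    K ⊆ A + Metric.ball 0 r := by
  rw [add_ball_zero]
  exact fun x hx => (le_iSup₂ (f := fun x (_ : x ∈ K) => Metric.infEDist x A) x hx).trans_lt h

theorem exists_norm_sub_le_of_excess_lt {K A : Set E} (hA : IsWeaklyCompact 𝕜 A) {r : ℝ}
    (h : excess K A < ENNReal.ofReal r) {Φ : StrongDual 𝕜 (StrongDual 𝕜 E)}
    (hΦ : StrongDual.toWeakDual Φ ∈
      closure (StrongDual.toWeakDual '' (inclusionInDoubleDual 𝕜 E '' K))) :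
    ∃ x ∈ A, ‖Φ - inclusionInDoubleDual 𝕜 E x‖ ≤ r := by
  have hJA : IsCompact (StrongDual.toWeakDual '' (inclusionInDoubleDual 𝕜 E '' A)) := by
    have := hA.image (inclusionInDoubleDualWeak 𝕜 E).continuous
    rw [Set.image_image] at this ⊢
    exact this
  have hJK : inclusionInDoubleDual 𝕜 E '' K ⊆
      inclusionInDoubleDual 𝕜 E '' A + Metric.closedBall 0 r := by
    refine (Set.image_mono (subset_add_ball_of_excess_lt h)).trans ?_
    rw [Set.image_add]
    refine Set.add_subset_add_left (Set.image_subset_iff.2 fun x hx => ?_)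
    exact (mem_closedBall_zero_iff (E := StrongDual 𝕜 (StrongDual 𝕜 E))).2
      ((double_dual_bound 𝕜 E x).trans (mem_ball_zero_iff.1 hx).le)
  obtain ⟨_, ⟨x, hx, rfl⟩, z, hz, rfl⟩ :=
    Set.mem_add.1 (mem_add_closedBall_of_mem_closure hJA hJK hΦ)
  refine ⟨x, hx, ?_⟩
  rw [← mem_closedBall_zero_iff (E := StrongDual 𝕜 (StrongDual 𝕜 E))]
  exact (add_sub_cancel_left (inclusionInDoubleDual 𝕜 E x) z).symm ▸ hz

theorem mem_range_of_forall_exists_norm_sub_le [CompleteSpace E] {D : Type*}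
    [NormedAddCommGroup D] [NormedSpace 𝕜 D] (J : E →ₗᵢ[𝕜] StrongDual 𝕜 D) {Φ : StrongDual 𝕜 D}
    (h : ∀ ε > 0, ∃ x, ‖Φ - J x‖ ≤ ε) : Φ ∈ Set.range J := by
  refine J.isometry.isClosedEmbedding.isClosed_range.closure_subset
    (Metric.mem_closure_iff.2 fun ε hε => ?_)
  obtain ⟨x, hx⟩ := h (ε / 2) (half_pos hε)
  exact ⟨J x, Set.mem_range_self x, by rw [dist_eq_norm]; linarith⟩

/-- Grothendieck's criterion for relative weak compactness. -/
theorem isRelativelyWeaklyCompact_of_deBlasi_eq_zero [CompleteSpace E] {K : Set E}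
    (hb : Bornology.IsBounded K) (h : deBlasi 𝕜 K = 0) : IsRelativelyWeaklyCompact 𝕜 K := by
  refine isRelativelyWeaklyCompact_of_closure_bidual hb fun Φ hΦ => ?_
  have happrox : ∀ ε > 0, ∃ x, ‖Φ - inclusionInDoubleDualLi 𝕜 x‖ ≤ ε := fun ε hε => by
    have hlt : deBlasi 𝕜 K < ENNReal.ofReal ε := by rwa [h, ENNReal.ofReal_pos]
    simp only [deBlasi, iInf_lt_iff] at hlt
    obtain ⟨A, -, hA, hKA⟩ := hlt
    obtain ⟨x, -, hx⟩ := exists_norm_sub_le_of_excess_lt hA hKA hΦ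
    exact ⟨x, hx⟩
  exact mem_range_of_forall_exists_norm_sub_le _ happrox

end WeakCompactness

section WeaklyPSummable

variable {E F : Type*} [NormedAddCommGroup E] [NormedSpace 𝕜 E]
  [NormedAddCommGroup F] [NormedSpace 𝕜 F] {p : ℝ≥0∞}

theorem tendsto_cofinite_zero_of_memℓp {α : Type*} {f : α → E} (hp : p ≠ ∞) (hf : Memℓp f p) :
    Tendsto f cofinite (𝓝 0) := by
  obtain rfl | rfl | hpos := p.trichotomy
  · exact tendsto_nhds_of_eventually_eq ((memℓp_zero_iff.1 hf).eventually_cofinite_notMem.mono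
      fun _ => not_not.1)
  · exact absurd rfl hp
  · have h := ((memℓp_gen_iff hpos).1 hf).tendsto_cofinite_zero.rpow_const (p := p.toReal⁻¹)
      (.inr (inv_nonneg.2 hpos.le))
    simp only [Real.rpow_rpow_inv (norm_nonneg _) hpos.ne',
      Real.zero_rpow (inv_ne_zero hpos.ne')] at h
    exact tendsto_zero_iff_norm_tendsto_zero.2 h

theorem memℓp_comp_injective {α β : Type*} {f : α → E} (hf : Memℓp f p) {g : β → α}
    (hg : Function.Injective g) : Memℓp (fun b => f (g b)) p := by
  obtain rfl | rfl | hpos := p.trichotomy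
  · exact memℓp_zero ((memℓp_zero_iff.1 hf).preimage hg.injOn)
  · exact memℓp_infty ((memℓp_infty_iff.1 hf).mono (Set.range_comp_subset_range g fun a => ‖f a‖))
  · exact (memℓp_gen_iff hpos).2 (((memℓp_gen_iff hpos).1 hf).comp_injective hg)

theorem WeaklyPSummable.weaklyNull {x : ℕ → E} (hx : WeaklyPSummable 𝕜 p x) :
    WeaklyNull 𝕜 x := by
  obtain rfl | hp := eq_or_ne p ∞
  · exact hx.1 rfl
  · exact fun f => Nat.cofinite_eq_atTop ▸ tendsto_cofinite_zero_of_memℓp hp (hx.2 hp f)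

theorem weaklyPSummable_zero : WeaklyPSummable 𝕜 p fun _ : ℕ => (0 : E) :=
  ⟨fun _ f => by simp, fun _ f => by
    simp only [map_zero]
    exact zero_memℓp (E := fun _ : ℕ => 𝕜)⟩

theorem WeaklyPSummable.comp_strictMono {x : ℕ → E} (hx : WeaklyPSummable 𝕜 p x) {φ : ℕ → ℕ}
    (hφ : StrictMono φ) : WeaklyPSummable 𝕜 p (x ∘ φ) :=
  ⟨fun hp f => (hx.1 hp f).comp hφ.tendsto_atTop,
    fun hp f => memℓp_comp_injective (hx.2 hp f) hφ.injective⟩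

theorem WeaklyNull.eq_of_sub {x : ℕ → E} {a b : E} (ha : WeaklyNull 𝕜 fun n => x n - a)
    (hb : WeaklyNull 𝕜 fun n => x n - b) : a = b := by
  refine (SeparatingDual.eq_iff_forall_dual_eq (R := 𝕜)).2 fun f => ?_
  have hsub : Tendsto (fun _ : ℕ => f b - f a) atTop (𝓝 0) := by
    simpa using (ha f).sub (hb f)
  exact (sub_eq_zero.1 (tendsto_nhds_unique tendsto_const_nhds hsub)).symm

theorem WeaklyNull.map {x : ℕ → E} (hx : WeaklyNull 𝕜 x) (T : E →L[𝕜] F) :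
    WeaklyNull 𝕜 fun n => T (x n) :=
  fun f => hx (f.comp T)

theorem WeaklyNull.tendsto_zero_of_isCompact {x : ℕ → E} (hx : WeaklyNull 𝕜 x) {s : Set E}
    (hs : IsCompact s) (hxs : ∀ n, x n ∈ s) : Tendsto x atTop (𝓝 0) := by
  refine hs.tendsto_nhds_of_unique_mapClusterPt (.of_forall hxs) fun y _ hy => ?_
  refine (SeparatingDual.eq_zero_iff_forall_dual_eq_zero (R := 𝕜) y).2 fun f => ?_
  exact eq_of_mapClusterPt_of_tendsto (hy.continuousAt_comp f.continuous.continuousAt) (hx f)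

theorem exists_strictMono_comp_eq_const_or_comp {α : Type*} {x y : ℕ → α} {a : α}
    (hy : ∀ n, y n ∈ insert a (Set.range x)) :
    ∃ φ : ℕ → ℕ, StrictMono φ ∧ ((∃ b ∈ insert a (Set.range x), y ∘ φ = fun _ => b) ∨
      ∃ ψ : ℕ → ℕ, StrictMono ψ ∧ y ∘ φ = x ∘ ψ) := by
  by_cases hfreq : ∃ b ∈ insert a (Set.range x), ∃ᶠ n in atTop, y n = b
  · obtain ⟨b, hb, hfreq⟩ := hfreq
    obtain ⟨φ, hφ, hyb⟩ := extraction_of_frequently_atTop hfreq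
    exact ⟨φ, hφ, .inl ⟨b, hb, funext hyb⟩⟩
  have hne : ∀ b ∈ insert a (Set.range x), ∀ᶠ n in atTop, y n ≠ b := by
    simpa only [not_exists, not_and, not_frequently] using hfreq
  obtain ⟨N, hN⟩ := eventually_atTop.1 (hne a (Set.mem_insert _ _))
  choose k hk using fun n => (hy (n + N)).resolve_left (hN _ (Nat.le_add_left N n))
  have hkt : Tendsto k atTop atTop := by
    rw [← Nat.cofinite_eq_atTop]
    refine le_cofinite_iff_eventually_ne.2 fun m => ?_
    rw [eventually_map, Nat.cofinite_eq_atTop]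
    filter_upwards [(tendsto_add_atTop_nat N).eventually
      (hne (x m) (Set.mem_insert_of_mem _ (Set.mem_range_self m)))] with n hn hkm
    exact hn (by rw [← hk, hkm])
  obtain ⟨φ, hφ, hkφ⟩ := strictMono_subseq_of_tendsto_atTop hkt
  exact ⟨fun n => φ n + N, hφ.add_const N, .inr ⟨k ∘ φ, hkφ, funext fun n => (hk (φ n)).symm⟩⟩

theorem WeaklyPSummable.exists_subseq_weaklyPConvergent {x : ℕ → E} (hx : WeaklyPSummable 𝕜 p x)
    {y : ℕ → E} (hy : ∀ n, y n ∈ insert 0 (Set.range x)) :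
    ∃ φ : ℕ → ℕ, StrictMono φ ∧
      ∃ a ∈ insert 0 (Set.range x), WeaklyPConvergent 𝕜 p (y ∘ φ) a := by
  obtain ⟨φ, hφ, ⟨b, hb, hyφ⟩ | ⟨ψ, hψ, hyφ⟩⟩ := exists_strictMono_comp_eq_const_or_comp hy
  · refine ⟨φ, hφ, b, hb, ?_⟩
    simpa only [hyφ, WeaklyPConvergent, sub_self] using weaklyPSummable_zero
  · refine ⟨φ, hφ, 0, Set.mem_insert _ _, ?_⟩
    simpa only [hyφ, WeaklyPConvergent, sub_zero] using hx.comp_strictMono hψ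

theorem WeaklyPSummable.isWeaklyPCompact_insert_zero_range {x : ℕ → E}
    (hx : WeaklyPSummable 𝕜 p x) : IsWeaklyPCompact 𝕜 p (insert 0 (Set.range x)) := by
  refine ⟨fun y hy => ?_, fun y a hy ha => ?_⟩
  · obtain ⟨φ, hφ, a, -, ha⟩ := hx.exists_subseq_weaklyPConvergent hy
    exact ⟨φ, a, hφ, ha⟩
  · obtain ⟨φ, hφ, b, hb, hyb⟩ := hx.exists_subseq_weaklyPConvergent hy
    rwa [WeaklyNull.eq_of_sub (WeaklyPSummable.weaklyNull (ha.comp_strictMono hφ)) hyb.weaklyNull]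

end WeaklyPSummable

section PseudoWeaklyCompact

variable {E F : Type*} [NormedAddCommGroup E] [NormedSpace 𝕜 E]
  [NormedAddCommGroup F] [NormedSpace 𝕜 F] {p : ℝ≥0∞}

theorem IsDunfordPettisSet.insert_zero {K : Set E} (hK : IsDunfordPettisSet 𝕜 K) :
    IsDunfordPettisSet 𝕜 (insert 0 K) := by
  refine ⟨hK.1.insert 0, fun f hf => Metric.tendstoUniformlyOn_iff.2 fun ε hε => ?_⟩
  filter_upwards [Metric.tendstoUniformlyOn_iff.1 (hK.2 f hf) ε hε] with n hn
  exact Set.forall_mem_insert.2 ⟨by simpa using hε, hn⟩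

theorem IsDunfordPettisSet.pRightNull_sub {K : Set E} (hK : IsDunfordPettisSet 𝕜 K)
    {x : ℕ → E} {a : E} (hx : ∀ n, x n ∈ K) (ha : a ∈ K) (h : WeaklyPConvergent 𝕜 p x a) :
    PRightNull 𝕜 p fun n => x n - a := by
  refine ⟨⟨(hK.1.sub hK.1).subset (Set.range_subset_iff.2 fun n => Set.sub_mem_sub (hx n) ha),
    fun f hf => Metric.tendstoUniformlyOn_iff.2 fun ε hε => ?_⟩, h⟩
  filter_upwards [Metric.tendstoUniformlyOn_iff.1 (hK.2 f hf) (ε / 2) (half_pos hε)] with n hn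
  refine Set.forall_mem_range.2 fun m => ?_
  rw [map_sub, dist_zero_left, ← dist_eq_norm]
  exact (dist_triangle_left _ _ 0).trans_lt ((add_lt_add (hn _ (hx m)) (hn _ ha)).trans_eq
    (add_halves ε))

theorem isPseudoWeaklyCompactOperator_iff {S : E →L[𝕜] F} :
    IsPseudoWeaklyCompactOperator p S ↔
      ∀ x : ℕ → E, PRightNull 𝕜 p x → Tendsto (fun n => S (x n)) atTop (𝓝 0) := by
  refine ⟨fun hS x hx => ?_, fun hS A hDP hA => ?_⟩
  · exact (hx.2.weaklyNull.map S).tendsto_zero_of_isCompact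
      (hS _ hx.1.insert_zero hx.2.isWeaklyPCompact_insert_zero_range) fun n =>
        subset_closure (Set.mem_image_of_mem S (Set.mem_insert_of_mem 0 (Set.mem_range_self n)))
  · refine IsCompact.closure (IsSeqCompact.isCompact fun y hy => ?_)
    choose x hxA hxy using hy
    obtain ⟨φ, a, hφ, ha⟩ := hA.1 x hxA
    have haA : a ∈ A := hA.2 _ a (fun n => hxA (φ n)) ha
    have hlim := hS _ (hDP.pRightNull_sub (fun n => hxA (φ n)) haA ha)
    refine ⟨S a, Set.mem_image_of_mem S haA, φ, hφ, tendsto_sub_nhds_zero_iff.1 ?_⟩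
    simpa only [map_sub, Function.comp_apply, hxy] using hlim

theorem tendstoUniformlyOn_image_closedBall_iff {T : E →L[𝕜] F} {f : ℕ → StrongDual 𝕜 F} :
    TendstoUniformlyOn (fun n y => f n y) (fun _ => 0) atTop (T '' Metric.closedBall 0 1) ↔
      Tendsto (fun n => dualOperator T (f n)) atTop (𝓝 0) := by
  let _ : NormedSpace ℝ E := NormedSpace.restrictScalars ℝ 𝕜 E
  rw [Metric.tendstoUniformlyOn_iff, Metric.tendsto_nhds]
  simp only [Set.forall_mem_image, mem_closedBall_zero_iff, dist_zero_left, dist_zero_right]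
  refine ⟨fun h ε hε => ?_, fun h ε hε => ?_⟩
  · filter_upwards [h (ε / 2) (half_pos hε)] with n hn
    refine ((dualOperator T (f n)).opNorm_le_of_unit_norm (half_pos hε).le
      fun x hx => (hn hx.le).le).trans_lt (half_lt_self hε)
  · filter_upwards [h ε hε] with n hn x hx
    exact ((dualOperator T (f n)).unit_le_opNorm x hx).trans_lt hn

theorem isPseudoWeaklyCompactOperator_dualOperator_iff {T : E →L[𝕜] F} :
    IsPseudoWeaklyCompactOperator p (dualOperator T) ↔
      IsPRightStarSet 𝕜 p (T '' Metric.closedBall 0 1) := by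
  have hb : Bornology.IsBounded (T '' Metric.closedBall 0 1) :=
    T.lipschitz.isBounded_image Metric.isBounded_closedBall
  simp only [isPseudoWeaklyCompactOperator_iff, IsPRightStarSet, hb, true_and,
    tendstoUniformlyOn_image_closedBall_iff]

end PseudoWeaklyCompact

section LpOne

variable {E : Type*} [NormedAddCommGroup E] [NormedSpace 𝕜 E] {p : ℝ≥0∞}

theorem hasSum_norm_lp_one (c : lp (fun _ : ℕ => 𝕜) 1) : HasSum (fun n => ‖c n‖) ‖c‖ := by
  simpa using lp.hasSum_norm (p := 1) (by simp) c

theorem norm_le_of_hasSum_smul {x : ℕ → E} {C : ℝ} (hx : ∀ n, ‖x n‖ ≤ C)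
    {c : lp (fun _ : ℕ => 𝕜) 1} {y : E} (hy : HasSum (fun n => c n • x n) y) :
    ‖y‖ ≤ C * ‖c‖ := by
  rw [← hy.tsum_eq]
  refine tsum_of_norm_bounded ((hasSum_norm_lp_one c).mul_left C) fun n => ?_
  rw [norm_smul, mul_comm]
  exact mul_le_mul_of_nonneg_right (hx n) (norm_nonneg _)

theorem exists_clm_lp_one [CompleteSpace E] {x : ℕ → E} {C : ℝ} (hx : ∀ n, ‖x n‖ ≤ C) :
    ∃ T : lp (fun _ : ℕ => 𝕜) 1 →L[𝕜] E, ∀ c, HasSum (fun n => c n • x n) (T c) := by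
  have hsum (c : lp (fun _ : ℕ => 𝕜) 1) : Summable fun n => c n • x n :=
    Summable.of_norm_bounded ((hasSum_norm_lp_one c).summable.mul_left C) fun n => by
      rw [norm_smul, mul_comm]
      exact mul_le_mul_of_nonneg_right (hx n) (norm_nonneg _)
  let L : lp (fun _ : ℕ => 𝕜) 1 →ₗ[𝕜] E :=
    { toFun := fun c => ∑' n, c n • x n
      map_add' := fun c d => by
        rw [← (hsum c).tsum_add (hsum d)]
        simp only [lp.coeFn_add, Pi.add_apply, add_smul]
      map_smul' := fun r c => by
        rw [RingHom.id_apply, ← (hsum c).tsum_const_smul r]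
        simp only [lp.coeFn_smul, Pi.smul_apply, smul_eq_mul, mul_smul] }
  exact ⟨L.mkContinuous C fun c => norm_le_of_hasSum_smul hx (hsum c).hasSum,
    fun c => (hsum c).hasSum⟩

theorem apply_lp_single_of_hasSum {x : ℕ → E} {T : lp (fun _ : ℕ => 𝕜) 1 →L[𝕜] E}
    (hT : ∀ c, HasSum (fun n => c n • x n) (T c)) (n : ℕ) : T (lp.single 1 n 1) = x n := by
  refine (hT _).unique ?_
  have h := hasSum_single (f := fun m => (lp.single 1 n (1 : 𝕜) : lp (fun _ : ℕ => 𝕜) 1) m • x m)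
    n fun m hm => by simp [lp.single_apply, hm]
  simpa using h

theorem IsPRightStarSet.of_forall_norm_le {K L : Set E} (hK : IsPRightStarSet 𝕜 p K)
    (hKL : ∀ (f : StrongDual 𝕜 E) (C : ℝ), 0 ≤ C → (∀ x ∈ K, ‖f x‖ ≤ C) → ∀ x ∈ L, ‖f x‖ ≤ C) :
    IsPRightStarSet 𝕜 p L := by
  obtain ⟨C, hC⟩ := hK.1.exists_norm_le
  refine ⟨isBounded_iff_forall_norm_le.2 ⟨max C 0, fun y hy => ?_⟩, fun f hf => ?_⟩
  · refine NormedSpace.norm_le_dual_bound 𝕜 y (le_max_right C 0) fun f => ?_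
    rw [mul_comm]
    refine hKL f _ (by positivity) (fun x hx => ?_) y hy
    exact f.le_opNorm_of_le ((hC x hx).trans (le_max_left C 0))
  · refine Metric.tendstoUniformlyOn_iff.2 fun ε hε => ?_
    filter_upwards [Metric.tendstoUniformlyOn_iff.1 (hK.2 f hf) (ε / 2) (half_pos hε)] with n hn
    simp only [dist_zero_left] at hn ⊢
    exact fun y hy => (hKL (f n) _ (half_pos hε).le (fun x hx => (hn x hx).le) y hy).trans_lt
      (half_lt_self hε)

theorem IsPRightStarSet.image_closedBall_lp_one {K : Set E} (hK : IsPRightStarSet 𝕜 p K)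
    {x : ℕ → E} (hx : ∀ n, x n ∈ K) {T : lp (fun _ : ℕ => 𝕜) 1 →L[𝕜] E}
    (hT : ∀ c, HasSum (fun n => c n • x n) (T c)) :
    IsPRightStarSet 𝕜 p (T '' Metric.closedBall 0 1) := by
  refine hK.of_forall_norm_le fun f C hC hfC => Set.forall_mem_image.2 fun c hc => ?_
  have hfT : HasSum (fun n => c n • f (x n)) (f (T c)) := by
    simpa only [map_smul] using f.hasSum (hT c)
  exact (norm_le_of_hasSum_smul (fun n => hfC _ (hx n)) hfT).trans
    (mul_le_of_le_one_right hC (mem_closedBall_zero_iff.1 hc))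

theorem hasPSRStar_of_forall_lp_one [CompleteSpace E]
    (h : ∀ T : lp (fun _ : ℕ => 𝕜) 1 →L[𝕜] E,
      IsPRightStarSet 𝕜 p (T '' Metric.closedBall 0 1) → IsWeaklyCompactOperator T) :
    HasPSRStar 𝕜 p E := by
  intro K hK
  refine isRelativelyWeaklyCompact_of_mapClusterPt hK.1 fun a ha => ?_
  obtain ⟨C, hC⟩ := hK.1.exists_norm_le
  obtain ⟨T, hT⟩ := exists_clm_lp_one (𝕜 := 𝕜) fun n => hC _ (ha n)
  have hTB := h T (hK.image_closedBall_lp_one ha hT)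
  refine IsRelativelyWeaklyCompact.exists_mapClusterPt hTB fun n =>
    ⟨lp.single 1 n 1, ?_, apply_lp_single_of_hasSum hT n⟩
  rw [mem_closedBall_zero_iff, lp.norm_single (by simp), norm_one]

end LpOne

section Equivalence

variable {E : Type*} [NormedAddCommGroup E] [NormedSpace 𝕜 E] {p : ℝ≥0∞}

theorem forall_isWeaklyCompactOperator_of_linearIsometryEquiv {D F : Type*}
    [NormedAddCommGroup D] [NormedSpace 𝕜 D] [NormedAddCommGroup F] [NormedSpace 𝕜 F]
    (e : D ≃ₗᵢ[𝕜] E)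
    (h : ∀ T : D →L[𝕜] F,
      IsPRightStarSet 𝕜 p (T '' Metric.closedBall 0 1) → IsWeaklyCompactOperator T)
    (T : E →L[𝕜] F) (hT : IsPRightStarSet 𝕜 p (T '' Metric.closedBall 0 1)) :
    IsWeaklyCompactOperator T := by
  have hball : e '' Metric.closedBall 0 1 = Metric.closedBall 0 1 := by
    rw [e.image_closedBall, map_zero]
  have he : T.comp (e.toContinuousLinearEquiv : D →L[𝕜] E) '' Metric.closedBall 0 1 =
      T '' Metric.closedBall 0 1 :=
    (Set.image_comp T e _).trans (congrArg (T '' ·) hball)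
  have hTe := h (T.comp (e.toContinuousLinearEquiv : D →L[𝕜] E))
  rw [IsWeaklyCompactOperator, he] at hTe
  exact hTe hT

theorem IsPRightStarSet.vartheta_eq_zero {K : Set E} (hne : K.Nonempty)
    (hK : IsPRightStarSet 𝕜 p K) : vartheta 𝕜 p K = 0 := by
  have hKK : excess K K = 0 := by
    simp +contextual [excess, Metric.infEDist_zero_of_mem]
  exact nonpos_iff_eq_zero.1 ((iInf₂_le_of_le K hne (iInf_le _ hK)).trans_eq hKK)

theorem HasPSRStar.deBlasi_le_vartheta (h : HasPSRStar 𝕜 p E) (K : Set E) :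
    deBlasi 𝕜 K ≤ vartheta 𝕜 p K := by
  refine le_iInf₂ fun A hne => le_iInf fun hA => ?_
  let B : Set E := toWeakSpace 𝕜 E ⁻¹' closure (toWeakSpace 𝕜 E '' A)
  have hAB : A ⊆ B := Set.image_subset_iff.1 subset_closure
  have hB : IsWeaklyCompact 𝕜 B := by
    rw [IsWeaklyCompact, Set.image_preimage_eq _ (toWeakSpace 𝕜 E).surjective]
    exact h A hA
  exact (iInf₂_le_of_le B (hne.mono hAB) (iInf_le _ hB)).trans
    (iSup₂_mono fun x _ => Metric.infEDist_anti hAB)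

end Equivalence

end RightStar

universe u

theorem theorem4p4_general {𝕜 : Type u} [RCLike 𝕜] (p : ℝ≥0∞)
    (X : Type v) [NormedAddCommGroup X] [NormedSpace 𝕜 X] [CompleteSpace X] :
    List.TFAE [
      ∀ (Y : Type (max u w)) [NormedAddCommGroup Y] [NormedSpace 𝕜 Y] [CompleteSpace Y]
        (T : Y →L[𝕜] X),
        IsPseudoWeaklyCompactOperator p (dualOperator T) → IsWeaklyCompactOperator T,
      ∀ T : lp (fun _ : ℕ => 𝕜) 1 →L[𝕜] X,
        IsPseudoWeaklyCompactOperator p (dualOperator T) → IsWeaklyCompactOperator T,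
      HasPSRStar 𝕜 p X,
      ∀ (Y : Type (max u w)) [NormedAddCommGroup Y] [NormedSpace 𝕜 Y] [CompleteSpace Y]
        (T : Y →L[𝕜] X),
        deBlasiOperator T ≤ varthetaOperator p T,
      ∀ K : Set X, Bornology.IsBounded K → deBlasi 𝕜 K ≤ vartheta 𝕜 p K] := by
  simp only [isPseudoWeaklyCompactOperator_dualOperator_iff]
  tfae_have 1 → 2 := fun h =>
    forall_isWeaklyCompactOperator_of_linearIsometryEquiv
      (LinearIsometryEquiv.ulift 𝕜 _ : ULift.{max u w} (lp (fun _ : ℕ => 𝕜) 1) ≃ₗᵢ[𝕜] _) (h _)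
  tfae_have 2 → 3 := hasPSRStar_of_forall_lp_one
  tfae_have 3 → 5 := fun h K _ => h.deBlasi_le_vartheta K
  tfae_have 5 → 4 := fun h Y _ _ _ T =>
    h _ (T.lipschitz.isBounded_image Metric.isBounded_closedBall)
  tfae_have 4 → 1 := fun h Y _ _ _ T hT =>
    isRelativelyWeaklyCompact_of_deBlasi_eq_zero hT.1 (nonpos_iff_eq_zero.1 ((h Y T).trans_eq
      (hT.vartheta_eq_zero ((Metric.nonempty_closedBall.2 zero_le_one).image T))))
  tfae_finish

theorem theorem4p4 {𝕜 : Type} [RCLike 𝕜] (p : ℝ≥0∞) (hp : 1 ≤ p)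
    (X : Type v) [NormedAddCommGroup X] [NormedSpace 𝕜 X] [CompleteSpace X] :
    List.TFAE [
      ∀ (Y : Type w) [NormedAddCommGroup Y] [NormedSpace 𝕜 Y] [CompleteSpace Y] (T : Y →L[𝕜] X),
        IsPseudoWeaklyCompactOperator p (dualOperator T) → IsWeaklyCompactOperator T,
      ∀ T : lp (fun _ : ℕ => 𝕜) 1 →L[𝕜] X,
        IsPseudoWeaklyCompactOperator p (dualOperator T) → IsWeaklyCompactOperator T,
      HasPSRStar 𝕜 p X,
      ∀ (Y : Type w) [NormedAddCommGroup Y] [NormedSpace 𝕜 Y] [CompleteSpace Y] (T : Y →L[𝕜] X),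
        deBlasiOperator T ≤ varthetaOperator p T,
      ∀ K : Set X, Bornology.IsBounded K → deBlasi 𝕜 K ≤ vartheta 𝕜 p K] :=
  theorem4p4_general p X
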